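/- **Setting.** Let $d,n\ge 1$ and let $K\subset\mathbb R^d$ be closed and convex, contain the unit Euclidean ball, and satisfy $\|\beta\|_2\le R$ for all $\beta\in K$. A fixed (oblivious) sequence of agents $a_t=(x_t,y_t,d_t)$, $t=1,\dots,n$, is given, with $x_t\in\mathbb R^d$, $y_t\in\{-1,1\}$. If $y_t=-1$ (strategic), then $d_t(u,v)=f_t(v-u)$, where $f_t:\mathbb R^d\to\mathbb R$ is convex, positive away from $0$, and positive homogeneous of some degree $r_t>1$; facing a classifier $\beta$, the agent reports some $\hat x_t(\beta)\in\arg\max_x\big(\langle\beta,x\rangle-d_t(x_t,x)\big)$, ties broken arbitrarily. If $y_t=1$ (non-strategic), then $\hat x_t(\beta)=x_t$. The loss is $c_t(\beta)=h(y_t\langle\hat x_t(\beta),\beta\rangle)$, where $h$ is either the logistic loss $h(z)=\log(1+e^{-z})$ or the hinge loss $h(z)=\max(0,1-z)$. Assume that, with constants $M,L>0$, for every $t$, $|c_t|\le M$ on $K$ and $c_t$ is $L$-Lipschitz on $K$ for $\|\cdot\|_2$. The Stackelberg regret of $B=(b_1,\dots,b_n)$ is $$\mathcal R_S(A,B)=\sum_{t=1}^n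 c_t(b_t)-\min_{\beta\in K}\sum_{t=1}^n c_t(\beta).$$ **Algorithm.** Let $\theta=\#\{t:y_t=-1\}/n$, $$\delta=\theta^{1/4}\sqrt{\tfrac{dMR}{L(R+3)}}\;n^{-1/4},\qquad \eta=\frac{R}{\sqrt{n\left(\theta\frac{d^2M^2}{\delta^2}+(1-\theta)L^2\right)}},\qquad K_\delta=\{(1-\delta)\beta:\beta\in K\}$$ (the term $\theta d^2M^2/\delta^2$ is read as $0$ if $\theta=0$), and assume $\delta\le1$; this holds whenever $n\ge (dMR/(L(R+3)))^2$. Start at a point $\beta_1\in K_\delta$ with $\|\beta-\beta_1\|_2\le R$ for all $\beta\in K$ (for instance $\beta_1=0$). In round $t$ draw $S_t$ uniformly from the unit sphere, independently of the past, deploy $\beta_t^+=\beta_t+\delta S_t$ and suffer $c_t(\beta_t^+)$. If $y_t=1$ let $g_t$ be a subgradient of $c_t$ at $\beta_t$; if $y_t=-1$ let $g_t=\frac d\delta c_t(\beta_t^+)S_t$. Let $\beta_{t+1}$ be the Euclidean projection of $\beta_t-\eta g_t$ onto $K_\delta$. **Corollary 4.** Both for the deployed classifiers $B=(\beta_1^+,\dots,\beta_n^+)$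 and for the iterates $B=(\beta_1,\dots,\beta_n)$, the Stackelberg regret is integrable and $$\mathbb E[\mathcal R_S(A,B)]\le LR\sqrt{n(1-\theta)}+2\,n^{3/4}\sqrt{dMLR(R+3)}\;\theta^{1/4}.$$ Consequently, for both choices of $B$: 1. if $\theta=0$, then $\mathbb E[\mathcal R_S(A,B)]\le C\sqrt n$, with $C$ depending only on $M,L,R$; 2. if $\theta\ge c$ for a constant $c>0$ (that is, $\theta=\Omega(1)$), then $\mathbb E[\mathcal R_S(A,B)]\le C\sqrt d\,n^{3/4}$, with $C$ depending only on $M,L,R,c$; 3. if $\theta\le c\,n^{-\gamma}$ for constants $c>0$ and $0\le\gamma\le1$ (that is, $\theta=O(n^{-\gamma})$), then $\mathbb E[\mathcal R_S(A,B)]\le C\sqrt d\,n^{1-\frac{1+\gamma}4}$, with $C$ depending only on $M,L,R,c,\gamma$. -/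

import Mathlib

open MeasureTheory ProbabilityTheory

universe u

noncomputable section

namespace StrategicClassification

/-- Feature vectors and classifiers live in `ℝ^d` with the Euclidean norm. -/
abbrev E (d : ℕ) : Type := EuclideanSpace ℝ (Fin d)

/-! ### Agents and best responses -/

/-- An agent `(x, y, dist)`: true feature vector, label in `{-1, 1}`, and the cost
`dist u v` of changing the feature vector `u` into `v`. -/
structure Agent (d : ℕ) where
  x : E d
  y : ℤ
  dist : E d → E d → ℝ
  label : y = 1 ∨ y = -1

/-- Strategic agents are those with label `-1`. -/
def Agent.Strategic {d : ℕ} (a : Agent d) : Prop := a.y = -1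

/-- The utility of an agent who reports `z` when the classifier is `β`. -/
def Agent.utility {d : ℕ} (a : Agent d) (β z : E d) : ℝ := inner ℝ β z - a.dist a.x z

/-- `r` is a reporting rule of the agent: a strategic agent reports some utility maximizer
(ties broken arbitrarily), a non-strategic agent reports the true features. -/
def Agent.IsResponse {d : ℕ} (a : Agent d) (r : E d → E d) : Prop :=
  (a.y = -1 → ∀ β z, a.utility β z ≤ a.utility β (r β)) ∧ (a.y = 1 → ∀ β, r β = a.x)

/-- The cost is `dist u v = f (v - u)` with `f` positive away from `0`, convex, and positive
homogeneous of some degree `k > 1`. -/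
def AdmissibleCost {d : ℕ} (dist : E d → E d → ℝ) : Prop :=
  ∃ (f : E d → ℝ) (k : ℝ), 1 < k ∧ (∀ v, v ≠ 0 → 0 < f v) ∧ ConvexOn ℝ Set.univ f ∧
    (∀ (α : ℝ) (v : E d), 0 < α → f (α • v) = α ^ k * f v) ∧ ∀ u v, dist u v = f (v - u)

/-! ### Losses -/

/-- The two classification losses. -/
inductive LossKind where
  | logistic
  | hinge

/-- `log (1 + e^{-z})` or `max (0, 1 - z)`. -/
def LossKind.h : LossKind → ℝ → ℝ
  | .logistic, z => Real.log (1 + Real.exp (-z))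
  | .hinge, z => max 0 (1 - z)

/-- The classification loss `c(x̂, y, β)`. -/
def LossKind.c {d : ℕ} (k : LossKind) (xhat : E d) (y : ℤ) (β : E d) : ℝ :=
  k.h ((y : ℝ) * inner ℝ xhat β)

/-! ### The repeated game -/

/-- An `n`-round instance: the loss function, the feasible set, the (obliviously chosen) sequence
of agents, and their reporting rules. -/
structure Game (d n : ℕ) where
  kind : LossKind
  K : Set (E d)
  closed : IsClosed K
  convex : Convex ℝ K
  unitBall : Metric.closedBall 0 1 ⊆ K
  agent : Fin n → Agent d
  cost : ∀ t, (agent t).Strategic → AdmissibleCost (agent t).dist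
  response : Fin n → E d → E d
  isResponse : ∀ t, (agent t).IsResponse (response t)

namespace Game

variable {d n : ℕ} (G : Game d n)

/-- The loss `c_t(β) = c(x̂_t(β), y_t, β)` of round `t`. -/
def loss (t : Fin n) (β : E d) : ℝ := G.kind.c (G.response t β) (G.agent t).y β

/-- The Stackelberg regret of the classifiers `B` against the best fixed classifier in `K`. -/
def regret (B : Fin n → E d) : ℝ :=
  (∑ t, G.loss t (B t)) - sInf ((fun β => ∑ t, G.loss t β) '' G.K)

/-- The fraction of strategic rounds. -/
def theta : ℝ :=
  (((Finset.univ : Finset (Fin n)).filter fun t => (G.agent t).y = -1).card : ℝ) / (n : ℝ)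

/-- The smoothing parameter. -/
def delta (M L R : ℝ) : ℝ :=
  G.theta ^ (1 / 4 : ℝ) * Real.sqrt (d * M * R / (L * (R + 3))) * (n : ℝ) ^ (-(1 / 4) : ℝ)

/-- The step size. For `θ = 0` (hence `δ = 0`) the first summand is read as `0`. -/
def eta (M L R : ℝ) : ℝ :=
  R / Real.sqrt (n * (G.theta * ((d : ℝ) ^ 2 * M ^ 2 / G.delta M L R ^ 2) +
    (1 - G.theta) * L ^ 2))

/-- The shrunken set `K_δ = {(1 - δ) β | β ∈ K}`. -/
def shrink (δ : ℝ) : Set (E d) := (fun β => (1 - δ) • β) '' G.K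

/-- `K` has norm at most `R`; each `c_t` is bounded by `M` and `L`-Lipschitz on `K`; the
smoothing parameter is at most `1`, so that all queries `β + δ S` with `β ∈ K_δ` lie in `K`. -/
structure Admissible (M L R : ℝ) : Prop where
  dim_pos : 0 < d
  rounds_pos : 0 < n
  M_pos : 0 < M
  L_pos : 0 < L
  norm_le : ∀ β ∈ G.K, ‖β‖ ≤ R
  loss_le : ∀ t, ∀ β ∈ G.K, |G.loss t β| ≤ M
  lipschitz : ∀ t, ∀ β ∈ G.K, ∀ β' ∈ G.K, |G.loss t β - G.loss t β'| ≤ L * ‖β - β'‖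
  delta_le : G.delta M L R ≤ 1

end Game

/-! ### The algorithm -/

/-- The uniform probability measure on the unit sphere of `ℝ^d`. -/
def sphereUniform (d : ℕ) : Measure (Metric.sphere (0 : E d) 1) :=
  ((volume : Measure (E d)).toSphere Set.univ)⁻¹ • (volume : Measure (E d)).toSphere

/-- `v` is a subgradient of `f` at `β`. -/
def IsSubgradient {d : ℕ} (f : E d → ℝ) (β v : E d) : Prop :=
  ∀ z, f β + inner ℝ v (z - β) ≤ f z

/-- `q` is the Euclidean projection of `p` onto `A`. -/
def IsProjection {d : ℕ} (A : Set (E d)) (p q : E d) : Prop :=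
  q ∈ A ∧ ∀ z ∈ A, ‖p - q‖ ≤ ‖p - z‖

/-- A run of convex optimization with mixture feedback on the probability space `(Ω, P)`, with
rounds numbered from `0`. `history t` is the information available before `S t` is drawn. The
subgradients of non-strategic rounds may be chosen in any non-anticipating way. -/
structure Run {d n : ℕ} (G : Game d n) (M L R : ℝ) {Ω : Type u} [mΩ : MeasurableSpace Ω]
    (P : Measure Ω) where
  history : Filtration ℕ mΩ
  /-- the random directions -/
  S : Fin n → Ω → Metric.sphere (0 : E d) 1
  /-- the iterates -/
  β : ℕ → Ω → E d
  /-- the stochastic subgradients -/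
  g : Fin n → Ω → E d
  /-- the initial point -/
  start : E d
  S_measurable : ∀ t : Fin n, Measurable[history (t + 1)] (S t)
  S_law : ∀ t : Fin n, P.map (S t) = sphereUniform d
  S_indep : ∀ t : Fin n,
    Indep (MeasurableSpace.comap (S t) inferInstance) (history (t : ℕ)) P
  β_measurable : ∀ t : Fin n, Measurable[history (t : ℕ)] (β t)
  start_mem : start ∈ G.shrink (G.delta M L R)
  start_dist : ∀ b ∈ G.K, ‖b - start‖ ≤ R
  init : ∀ ω, β 0 ω = start
  g_nonstrategic : ∀ t : Fin n, (G.agent t).y = 1 →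
    ∀ ω, IsSubgradient (G.loss t) (β t ω) (g t ω)
  g_strategic : ∀ t : Fin n, (G.agent t).y = -1 → ∀ ω, g t ω =
    ((d : ℝ) / G.delta M L R * G.loss t (β t ω + G.delta M L R • (S t ω : E d))) •
      (S t ω : E d)
  update : ∀ (t : Fin n) (ω : Ω), IsProjection (G.shrink (G.delta M L R))
    (β t ω - G.eta M L R • g t ω) (β (t + 1) ω)

namespace Run

variable {d n : ℕ} {G : Game d n} {M L R : ℝ} {Ω : Type u} [MeasurableSpace Ω] {P : Measure Ω}

/-- The classifiers `β_t⁺ = β_t + δ S_t` that are deployed and whose loss is suffered. -/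
def deployed (run : Run G M L R P) (t : Fin n) (ω : Ω) : E d :=
  run.β t ω + G.delta M L R • (run.S t ω : E d)

/-- The unperturbed iterates `β_t`. -/
def iterate (run : Run G M L R P) (t : Fin n) (ω : Ω) : E d := run.β t ω

end Run

/-- The expected Stackelberg regret of a random sequence of classifiers. -/
def expectedRegret {d n : ℕ} (G : Game d n) {Ω : Type u} [MeasurableSpace Ω] (P : Measure Ω)
    (B : Fin n → Ω → E d) : ℝ :=
  ∫ ω, G.regret (fun t => B t ω) ∂P

end StrategicClassification

end

/-!
The algorithm is projected online gradient descent in which the gradients of the strategic rounds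
are replaced by the one-point estimates `(d / δ) c_t(β_t + δ S_t) S_t`. Four facts carry the proof.

*The losses are convex.* For a non-strategic agent the score is linear in `β`. For a strategic agent
the optimal utility is a supremum of functions affine in `β`, hence convex, and Euler's identity for
the homogeneous cost (`inner_response_sub_eq`) shows that the score `⟪r β, β⟫` is a positive
multiple of it plus a linear function; the loss is a convex nondecreasing function of that score
(`Game.convexOn_loss`). In particular the score does not depend on how ties are broken.

*The one-point estimate is almost a subgradient.* The derivative of `∫_B F(x + ε w) dx` at `ε = 0`,
with `B` the unit ball, is the sphere integral `∫ F(s) ⟪w, s⟫ dσ(s)`. In polar coordinates this only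
differentiates the radius at which a ray leaves the displaced ball, so `F` need not be
differentiable (`hasDerivAt_setIntegral_ball_add_smul`). Since `ε ↦ ∫_B F(x + ε w) dx` is convex,
the sphere integral is at most the increment from `ε = 0` to `ε = 1`
(`integral_toSphere_mul_inner_le`), and the Lipschitz bound on `K` turns the ball averages into
values at the centres at a cost of `2 L δ` (`sub_le_integral_sphereUniform`). As `S_t` is
independent of the past, this can be integrated over `β_t` (`Run.integral_loss_iterate_sub_le`).

*Gradient descent holds path by path.* The projection inequality telescopes, so with the given `η`
the linearized regret against any point of `K_δ` is at most `R √A`, where `A` is the sum of the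
bounds on `‖g_t‖²` (`Run.sum_linearized_le`). In non-strategic rounds `‖g_t‖ ≤ L` needs an argument
at boundary points of `K` (`IsSubgradient.norm_le_of_linear_score`).

*The errors add up to `n L δ (R + 3)`*: per round `2 L δ` from smoothing, `L δ` from deploying
`β_t⁺` instead of `β_t`, and `L δ R` from moving the comparator into `K_δ`
(`Run.sum_integral_loss_sub_le`). The choice of `δ` makes this equal to the strategic part of `R √A`
(`Game.Admissible.smoothing_error_eq`, `Game.Admissible.variance_term_eq`).
-/

/-! ### Derivatives of ball averages -/

open Set Metric Module in
/-- Integration in polar coordinates for an additive Haar measure on a normed space. -/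
theorem integral_eq_integral_toSphere_integral_Ioi {V : Type*} [NormedAddCommGroup V]
    [NormedSpace ℝ V] [FiniteDimensional ℝ V] [Nontrivial V] [MeasurableSpace V] [BorelSpace V]
    (μ : Measure V) [μ.IsAddHaarMeasure] {f : V → ℝ} (hf : Integrable f μ) :
    ∫ x, f x ∂μ = ∫ s, ∫ r in Ioi (0 : ℝ), r ^ (finrank ℝ V - 1) * f (r • (s : V))
      ∂volume ∂μ.toSphere := by
  have hmp := μ.measurePreserving_homeomorphUnitSphereProd
  set g : sphere (0 : V) 1 × Ioi (0 : ℝ) → ℝ := fun p => f (p.2.1 • (p.1 : V)) with hg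
  have hfg : ∀ x : ({(0 : V)}ᶜ : Set V), g (homeomorphUnitSphereProd V x) = f x := by
    intro x
    have hx : ‖(x : V)‖ ≠ 0 := norm_ne_zero_iff.2 x.2
    simp [hg, smul_smul, hx]
  have hgint : Integrable g (μ.toSphere.prod (.volumeIoiPow (finrank ℝ V - 1))) := by
    rw [← hmp.integrable_comp_emb (Homeomorph.measurableEmbedding _)]
    have : g ∘ homeomorphUnitSphereProd V = f ∘ (↑) := funext hfg
    rw [this, ← integrableOn_iff_comap_subtypeVal (measurableSet_singleton _).compl]
    exact hf.integrableOn
  calc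
    ∫ x, f x ∂μ = ∫ x : ({(0)}ᶜ : Set V), f x.1 ∂(μ.comap (↑)) := by
      rw [integral_subtype_comap (measurableSet_singleton _).compl f, restrict_compl_singleton]
    _ = ∫ p, g p ∂μ.toSphere.prod (.volumeIoiPow (finrank ℝ V - 1)) := by
      rw [← hmp.integral_comp (Homeomorph.measurableEmbedding _)]
      exact integral_congr_ae (.of_forall fun x => (hfg x).symm)
    _ = ∫ s, ∫ r, g (s, r) ∂(.volumeIoiPow (finrank ℝ V - 1)) ∂μ.toSphere :=
      integral_prod _ hgint
    _ = _ := by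
      congr 1 with s
      simp only [Measure.volumeIoiPow, ENNReal.ofReal, hg]
      rw [integral_withDensity_eq_integral_smul
          ((measurable_subtype_coe.pow_const _).real_toNNReal),
        integral_subtype_comap measurableSet_Ioi
          fun a ↦ Real.toNNReal (a ^ (finrank ℝ V - 1)) • f (a • (s : V))]
      refine setIntegral_congr_fun measurableSet_Ioi fun x hx ↦ ?_
      simp only [NNReal.smul_def, smul_eq_mul]
      rw [Real.coe_toNNReal _ (pow_nonneg (le_of_lt hx) _)]

section RayExit

variable {V : Type*} [NormedAddCommGroup V] [InnerProductSpace ℝ V]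

/-- The distance from the origin at which the ray in the unit direction `s` leaves the unit ball
centred at `ε • w`; meaningful when `|ε| * ‖w‖ < 1`, so that the origin lies in this ball. -/
noncomputable def rayExit (w s : V) (ε : ℝ) : ℝ :=
  ε * inner ℝ w s + Real.sqrt (1 - ε ^ 2 * (‖w‖ ^ 2 - inner ℝ w s ^ 2))

/-- The derivative of `rayExit w s` in the displacement `ε`. -/
noncomputable def rayExitDeriv (w s : V) (ε : ℝ) : ℝ :=
  inner ℝ w s + -(2 * ε * (‖w‖ ^ 2 - inner ℝ w s ^ 2)) /
    (2 * Real.sqrt (1 - ε ^ 2 * (‖w‖ ^ 2 - inner ℝ w s ^ 2)))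

theorem rayExit_zero (w s : V) : rayExit w s 0 = 1 := by simp [rayExit]

theorem rayExitDeriv_zero (w s : V) : rayExitDeriv w s 0 = inner ℝ w s := by simp [rayExitDeriv]

theorem sq_mul_inner_lt_rayExit_discr {w s : V} {ε : ℝ} (h : |ε| * ‖w‖ < 1) :
    (ε * inner ℝ w s) ^ 2 < 1 - ε ^ 2 * (‖w‖ ^ 2 - inner ℝ w s ^ 2) := by
  have h1 : (|ε| * ‖w‖) ^ 2 < 1 := by
    have : 0 ≤ |ε| * ‖w‖ := by positivity
    nlinarith
  rw [mul_pow, sq_abs] at h1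
  nlinarith

theorem rayExit_discr_pos {w : V} (s : V) {ε : ℝ} (h : |ε| * ‖w‖ < 1) :
    0 < 1 - ε ^ 2 * (‖w‖ ^ 2 - inner ℝ w s ^ 2) :=
  (sq_nonneg _).trans_lt (sq_mul_inner_lt_rayExit_discr h)

theorem rayExit_pos {w : V} (s : V) {ε : ℝ} (h : |ε| * ‖w‖ < 1) : 0 < rayExit w s ε := by
  have := (Real.sq_lt.1 (sq_mul_inner_lt_rayExit_discr (s := s) h)).1
  unfold rayExit
  linarith

theorem norm_smul_sub_smul_lt_one_iff {w s : V} (hs : ‖s‖ = 1) {ε r : ℝ} (h : |ε| * ‖w‖ < 1)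
    (hr : 0 < r) : ‖r • s - ε • w‖ < 1 ↔ r < rayExit w s ε := by
  have hD := Real.sq_lt.1 (sq_mul_inner_lt_rayExit_discr (s := s) h)
  have hsq : ‖r • s - ε • w‖ ^ 2 =
      (r - ε * inner ℝ w s) ^ 2 + ε ^ 2 * (‖w‖ ^ 2 - inner ℝ w s ^ 2) := by
    rw [norm_sub_sq_real, norm_smul, norm_smul, inner_smul_left, inner_smul_right, hs, mul_pow,
      mul_pow, Real.norm_eq_abs, Real.norm_eq_abs, sq_abs, sq_abs, real_inner_comm]
    simp only [conj_trivial]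
    ring
  have h1 : ‖r • s - ε • w‖ < 1 ↔
      (r - ε * inner ℝ w s) ^ 2 < 1 - ε ^ 2 * (‖w‖ ^ 2 - inner ℝ w s ^ 2) := by
    rw [← sq_lt_one_iff₀ (norm_nonneg _), hsq, lt_sub_iff_add_lt]
  rw [h1, Real.sq_lt]
  unfold rayExit
  constructor
  · rintro ⟨-, h⟩
    linarith
  · intro h
    constructor <;> linarith

theorem hasDerivAt_rayExit {w : V} (s : V) {ε : ℝ} (h : |ε| * ‖w‖ < 1) :
    HasDerivAt (rayExit w s) (rayExitDeriv w s ε) ε := by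
  have hD := rayExit_discr_pos s h
  have h1 : HasDerivAt (fun e : ℝ => 1 - e ^ 2 * (‖w‖ ^ 2 - inner ℝ w s ^ 2))
      (-(2 * ε * (‖w‖ ^ 2 - inner ℝ w s ^ 2))) ε := by
    simpa using ((hasDerivAt_pow 2 ε).mul_const (‖w‖ ^ 2 - inner ℝ w s ^ 2)).const_sub 1
  have h2 : HasDerivAt (fun e : ℝ => e * inner ℝ w s) (inner ℝ w s) ε := by
    simpa using (hasDerivAt_id ε).mul_const (inner ℝ w s)
  exact h2.add (h1.sqrt hD.ne')

theorem continuousOn_rayExit (w : V) :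
    ContinuousOn (fun p : ℝ × V => rayExit w p.2 p.1) {p | |p.1| * ‖w‖ < 1} := by
  unfold rayExit
  fun_prop

theorem continuousOn_rayExitDeriv (w : V) :
    ContinuousOn (fun p : ℝ × V => rayExitDeriv w p.2 p.1) {p | |p.1| * ‖w‖ < 1} := by
  unfold rayExitDeriv
  refine ContinuousOn.add (by fun_prop) (ContinuousOn.div (by fun_prop) (by fun_prop) ?_)
  intro p hp
  exact mul_ne_zero two_ne_zero (Real.sqrt_pos.2 (rayExit_discr_pos p.2 hp)).ne'

end RayExit

section BallAverage

open Set Metric Module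

variable {V : Type*} [NormedAddCommGroup V] [InnerProductSpace ℝ V] [FiniteDimensional ℝ V]
  [MeasurableSpace V] [BorelSpace V] (μ : Measure V) [μ.IsAddHaarMeasure]

theorem setIntegral_ball_add_smul_eq [Nontrivial V] {F : V → ℝ} (hF : Continuous F) {w : V} {ε : ℝ}
    (h : |ε| * ‖w‖ < 1) :
    ∫ x in ball (0 : V) 1, F (x + ε • w) ∂μ =
      ∫ s : sphere (0 : V) 1, (∫ r in (0 : ℝ)..rayExit w (s : V) ε,
        r ^ (finrank ℝ V - 1) * F (r • (s : V))) ∂μ.toSphere := by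
  have h1 : ∫ x in ball (0 : V) 1, F (x + ε • w) ∂μ =
      ∫ x, (ball (ε • w) 1).indicator F x ∂μ := by
    rw [← integral_indicator measurableSet_ball,
      ← integral_add_right_eq_self ((ball (ε • w) 1).indicator F) (ε • w)]
    congr 1 with x
    simp [indicator]
  have hint : Integrable ((ball (ε • w) 1).indicator F) μ := by
    rw [integrable_indicator_iff measurableSet_ball]
    exact (hF.continuousOn.integrableOn_compact (isCompact_closedBall _ _)).mono_set
      ball_subset_closedBall
  rw [h1, integral_eq_integral_toSphere_integral_Ioi μ hint]
  congr 1 with s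
  have hs : ‖(s : V)‖ = 1 := by simp
  rw [intervalIntegral.integral_of_le (rayExit_pos _ h).le, integral_Ioc_eq_integral_Ioo,
    ← integral_indicator measurableSet_Ioi, ← integral_indicator measurableSet_Ioo]
  congr 1 with r
  by_cases hr : 0 < r
  · by_cases hr' : r < rayExit w (s : V) ε
    · have := (norm_smul_sub_smul_lt_one_iff hs h hr).2 hr'
      simp [indicator, hr, hr', dist_eq_norm, this]
    · have := mt (norm_smul_sub_smul_lt_one_iff hs h hr).1 hr'
      simp [indicator, hr, hr', dist_eq_norm, this]
  · simp [indicator, hr]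

/-- The derivative of a ball average in the direction `w` is a sphere integral. This is the
divergence theorem for the ball; `F` only has to be continuous, because the derivative falls on
the domain of integration. -/
theorem hasDerivAt_setIntegral_ball_add_smul [Nontrivial V] {F : V → ℝ} (hF : Continuous F)
    (w : V) :
    HasDerivAt (fun ε : ℝ => ∫ x in ball (0 : V) 1, F (x + ε • w) ∂μ)
      (∫ s : sphere (0 : V) 1, F s * inner ℝ w (s : V) ∂μ.toSphere) 0 := by
  set ε₀ : ℝ := 1 / (2 * (‖w‖ + 1)) with hε₀
  have hε₀pos : 0 < ε₀ := by positivity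
  have hsmall : ∀ ε ∈ Icc (-ε₀) ε₀, |ε| * ‖w‖ < 1 := by
    intro ε hε
    have h1 : |ε| ≤ ε₀ := abs_le.2 hε
    calc |ε| * ‖w‖ ≤ ε₀ * ‖w‖ := by gcongr
      _ < 1 := by
        rw [hε₀, div_mul_eq_mul_div, div_lt_one (by positivity)]
        linarith [norm_nonneg w]
  set k := finrank ℝ V - 1
  set Φ' : ℝ → sphere (0 : V) 1 → ℝ := fun ε s =>
    (rayExit w (s : V) ε ^ k * F (rayExit w (s : V) ε • (s : V))) * rayExitDeriv w (s : V) ε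
    with hΦ'
  have hmaps : MapsTo (fun p : ℝ × sphere (0 : V) 1 => (p.1, (p.2 : V)))
      (Icc (-ε₀) ε₀ ×ˢ univ) {p | |p.1| * ‖w‖ < 1} := fun p hp => hsmall _ hp.1
  have hc1 : ContinuousOn (fun p : ℝ × sphere (0 : V) 1 => rayExit w (p.2 : V) p.1)
      (Icc (-ε₀) ε₀ ×ˢ univ) :=
    (continuousOn_rayExit w).comp (by fun_prop) hmaps
  have hc2 : ContinuousOn (fun p : ℝ × sphere (0 : V) 1 => rayExitDeriv w (p.2 : V) p.1)
      (Icc (-ε₀) ε₀ ×ˢ univ) :=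
    (continuousOn_rayExitDeriv w).comp (by fun_prop) hmaps
  have hcont : ContinuousOn (fun p : ℝ × sphere (0 : V) 1 => Φ' p.1 p.2)
      (Icc (-ε₀) ε₀ ×ˢ univ) := by
    refine ((hc1.pow k).mul (hF.comp_continuousOn (hc1.smul ?_))).mul hc2
    fun_prop
  obtain ⟨C, hC⟩ := (isCompact_Icc.prod isCompact_univ).exists_bound_of_continuousOn hcont
  have hslice : ∀ ε ∈ Icc (-ε₀) ε₀,
      Continuous fun s : sphere (0 : V) 1 => rayExit w (s : V) ε := by
    intro ε hε
    rw [← continuousOn_univ]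
    exact hc1.comp (f := fun s : sphere (0 : V) 1 => (ε, s)) (by fun_prop)
      fun s _ => ⟨hε, mem_univ _⟩
  have hmeas : ∀ ε ∈ Icc (-ε₀) ε₀, Continuous fun s : sphere (0 : V) 1 =>
      ∫ r in (0 : ℝ)..rayExit w (s : V) ε, r ^ k * F (r • (s : V)) := by
    intro ε hε
    refine intervalIntegral.continuous_parametric_intervalIntegral_of_continuous ?_
      (hslice ε hε)
    fun_prop
  have hnhds : Icc (-ε₀) ε₀ ∈ nhds (0 : ℝ) := Icc_mem_nhds (by linarith) hε₀pos
  have h0 : (0 : ℝ) ∈ Icc (-ε₀) ε₀ := mem_of_mem_nhds hnhds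
  have key := hasDerivAt_integral_of_dominated_loc_of_deriv_le (μ := μ.toSphere)
    (F := fun (ε : ℝ) (s : sphere (0 : V) 1) =>
      ∫ r in (0 : ℝ)..rayExit w (s : V) ε, r ^ k * F (r • (s : V)))
    (F' := Φ') (x₀ := (0 : ℝ)) (s := Icc (-ε₀) ε₀) (bound := fun _ => C) hnhds
    (Filter.eventually_of_mem hnhds fun ε hε => (hmeas ε hε).aestronglyMeasurable)
    ((hmeas 0 h0).integrable_of_hasCompactSupport
      (HasCompactSupport.of_compactSpace _))
    (by
      have : Continuous (Φ' 0) := by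
        rw [← continuousOn_univ]
        exact hcont.comp (f := fun s : sphere (0 : V) 1 => ((0 : ℝ), s)) (by fun_prop)
          fun s _ => ⟨h0, mem_univ _⟩
      exact this.aestronglyMeasurable)
    (.of_forall fun s ε hε => hC (ε, s) ⟨hε, mem_univ _⟩)
    (integrable_const _)
    (.of_forall fun s ε hε => by
      have hcs : Continuous fun r : ℝ => r ^ k * F (r • (s : V)) := by fun_prop
      exact (intervalIntegral.integral_hasDerivAt_right (hcs.intervalIntegrable _ _)
        (hcs.stronglyMeasurableAtFilter _ _) hcs.continuousAt).comp ε
          (hasDerivAt_rayExit (s : V) (hsmall ε hε)))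
  have hval : ∫ s, Φ' 0 s ∂μ.toSphere =
      ∫ s : sphere (0 : V) 1, F s * inner ℝ w (s : V) ∂μ.toSphere := by
    simp [hΦ', rayExit_zero, rayExitDeriv_zero]
  rw [← hval]
  exact key.2.congr_of_eventuallyEq (Filter.eventually_of_mem hnhds fun ε hε =>
    setIntegral_ball_add_smul_eq μ hF (hsmall ε hε))

/-- For convex `F`, the sphere integral `∫ F(s) s` is, up to normalization, a subgradient at `0`
of the smoothing of `F` by averages over unit balls. -/
theorem integral_toSphere_mul_inner_le [Nontrivial V] {F : V → ℝ} (hF : ConvexOn ℝ univ F)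
    (w : V) :
    ∫ s : sphere (0 : V) 1, F s * inner ℝ w (s : V) ∂μ.toSphere ≤
      ∫ x in ball (0 : V) 1, F (x + w) ∂μ - ∫ x in ball (0 : V) 1, F x ∂μ := by
  have hc : Continuous F := continuousOn_univ.1 (hF.continuousOn isOpen_univ)
  have hint : ∀ v : V, IntegrableOn (fun x => F (x + v)) (ball (0 : V) 1) μ := fun v =>
    ((by fun_prop : Continuous fun x => F (x + v)).continuousOn.integrableOn_compact
      (isCompact_closedBall _ _)).mono_set ball_subset_closedBall
  have hconv : ConvexOn ℝ univ fun ε : ℝ => ∫ x in ball (0 : V) 1, F (x + ε • w) ∂μ := by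
    refine ⟨convex_univ, fun a _ b _ p q hp hq hpq => ?_⟩
    simp only [smul_eq_mul]
    rw [← integral_const_mul, ← integral_const_mul,
      ← integral_add ((hint _).const_mul _) ((hint _).const_mul _)]
    refine integral_mono (hint _) (((hint _).const_mul _).add ((hint _).const_mul _)) fun x => ?_
    have := hF.2 (mem_univ (x + a • w)) (mem_univ (x + b • w)) hp hq hpq
    have hx : p • (x + a • w) + q • (x + b • w) = x + (p * a + q * b) • w := by
      have : x = (p + q) • x := by rw [hpq, one_smul]
      nth_rewrite 3 [this]
      module
    rw [hx] at this
    exact this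
  have := hconv.le_slope_of_hasDerivAt (mem_univ 0) (mem_univ 1) one_pos
    (hasDerivAt_setIntegral_ball_add_smul μ hc w)
  simpa [slope_def_field] using this

end BallAverage

namespace StrategicClassification

/-! ### Convexity of the losses -/

section

theorem hasDerivAt_log_one_add_exp_neg (z : ℝ) :
    HasDerivAt (fun z => Real.log (1 + Real.exp (-z))) (-(1 + Real.exp z)⁻¹) z := by
  have h1 : HasDerivAt (fun z => 1 + Real.exp (-z)) (-Real.exp (-z)) z := by
    simpa using ((hasDerivAt_neg z).exp).const_add 1
  convert h1.log (by positivity) using 1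
  rw [Real.exp_neg]
  have := Real.exp_pos z
  field_simp
  ring

theorem LossKind.convexOn_h (k : LossKind) : ConvexOn ℝ Set.univ k.h := by
  cases k with
  | logistic =>
    refine Monotone.convexOn_univ_of_deriv
      (fun z => (hasDerivAt_log_one_add_exp_neg z).differentiableAt) ?_
    intro a b hab
    have hd : ∀ z, deriv LossKind.logistic.h z = -(1 + Real.exp z)⁻¹ := fun z =>
      (hasDerivAt_log_one_add_exp_neg z).deriv
    rw [hd, hd]
    gcongr
  | hinge =>
    exact (convexOn_const 0 convex_univ).sup
      ((convexOn_const 1 convex_univ).sub (concaveOn_id convex_univ))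

theorem LossKind.antitone_h (k : LossKind) : Antitone k.h := by
  intro a b hab
  cases k with
  | logistic =>
    simp only [LossKind.h]
    gcongr
  | hinge =>
    simp only [LossKind.h]
    gcongr

variable {d : ℕ}

/-- First-order condition for a best response: scaling the manipulation `r β - x` by `α` changes
the utility by `α a - α ^ k b`, which is stationary at `α = 1`. This is Euler's identity for the
cost, and it makes the gain `⟪β, r β - x⟫` a fixed multiple of the optimal net utility. -/
theorem inner_response_sub_eq {a : Agent d} {f : E d → ℝ} {k : ℝ} {β z : E d}
    (hhom : ∀ (α : ℝ) (v : E d), 0 < α → f (α • v) = α ^ k * f v)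
    (hdist : ∀ u v, a.dist u v = f (v - u)) (hz : ∀ z', a.utility β z' ≤ a.utility β z) :
    inner ℝ β (z - a.x) = k * f (z - a.x) := by
  have hmax : IsLocalMax (fun α : ℝ => α * inner ℝ β (z - a.x) - α ^ k * f (z - a.x)) 1 := by
    filter_upwards [lt_mem_nhds (zero_lt_one' ℝ)] with α hα
    have h := hz (a.x + α • (z - a.x))
    simp only [Agent.utility, hdist, add_sub_cancel_left, inner_add_right, inner_smul_right,
      hhom α _ hα] at h
    simp only [Real.one_rpow, one_mul]
    have h2 : inner ℝ β z = inner ℝ β a.x + inner ℝ β (z - a.x) := by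
      rw [← inner_add_right, add_sub_cancel]
    linarith
  have hder : HasDerivAt (fun α : ℝ => α * inner ℝ β (z - a.x) - α ^ k * f (z - a.x))
      (1 * inner ℝ β (z - a.x) - (k * 1 ^ (k - 1)) * f (z - a.x)) 1 :=
    ((hasDerivAt_id 1).mul_const _).sub
      ((Real.hasDerivAt_rpow_const (Or.inl one_ne_zero)).mul_const _)
  have := hmax.hasDerivAt_eq_zero hder
  simp only [Real.one_rpow] at this
  linarith

/-- The optimal utility is a supremum of functions affine in the classifier. -/
theorem convexOn_utility_response {a : Agent d} {r : E d → E d}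
    (hr : ∀ β z, a.utility β z ≤ a.utility β (r β)) :
    ConvexOn ℝ Set.univ fun β => a.utility β (r β) := by
  refine ⟨convex_univ, fun β _ β' _ p q hp hq hpq => ?_⟩
  have haff : ∀ z, a.utility (p • β + q • β') z = p * a.utility β z + q * a.utility β' z := by
    intro z
    simp only [Agent.utility, inner_add_left, inner_smul_left, conj_trivial]
    linear_combination -(a.dist a.x z) * hpq.symm
  simp only [haff, smul_eq_mul]
  gcongr
  · exact hr _ _
  · exact hr _ _

theorem convexOn_inner_response {a : Agent d} {r : E d → E d} (hcost : AdmissibleCost a.dist)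
    (hr : ∀ β z, a.utility β z ≤ a.utility β (r β)) :
    ConvexOn ℝ Set.univ fun β => inner ℝ (r β) β := by
  obtain ⟨f, k, hk, -, -, hhom, hdist⟩ := hcost
  have hlin : ∀ c : E d, ConvexOn ℝ Set.univ fun β : E d => inner ℝ c β := fun c =>
    (innerSL ℝ c).toLinearMap.convexOn convex_univ
  have heq : (fun β => inner ℝ (r β) β) = fun β =>
      (k / (k - 1)) • (a.utility β (r β) + inner ℝ (-a.x) β) + inner ℝ a.x β := by
    funext β
    have h1 := inner_response_sub_eq hhom hdist (hr β)
    have hk1 : k - 1 ≠ 0 := by linarith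
    simp only [Agent.utility, hdist, inner_neg_left, smul_eq_mul]
    rw [inner_sub_right, real_inner_comm (r β) β, real_inner_comm a.x β] at h1
    rw [real_inner_comm (r β) β]
    field_simp
    linear_combination (-1) * h1
  rw [heq]
  exact (((convexOn_utility_response hr).add (hlin _)).smul
    (div_nonneg (by linarith) (by linarith))).add (hlin _)

theorem Game.convexOn_loss {n : ℕ} (G : Game d n) (t : Fin n) :
    ConvexOn ℝ Set.univ (G.loss t) := by
  rcases (G.agent t).label with hy | hy
  · have : G.loss t = G.kind.h ∘ (innerSL ℝ (G.agent t).x).toLinearMap := by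
      funext β
      simp [Game.loss, LossKind.c, hy, (G.isResponse t).2 hy β]
    rw [this]
    exact G.kind.convexOn_h.comp_linearMap _
  · have hh : ConvexOn ℝ Set.univ fun z => G.kind.h (-z) :=
      G.kind.convexOn_h.comp_linearMap (-LinearMap.id)
    have hm : Monotone fun z => G.kind.h (-z) := fun a b hab =>
      G.kind.antitone_h (neg_le_neg hab)
    have : G.loss t = (fun z => G.kind.h (-z)) ∘ fun β => inner ℝ (G.response t β) β := by
      funext β
      simp [Game.loss, LossKind.c, hy]
    rw [this]
    have hin := convexOn_inner_response (G.cost t hy) ((G.isResponse t).1 hy)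
    refine ⟨convex_univ, fun β hβ β' hβ' p q hp hq hpq => ?_⟩
    exact (hm (hin.2 hβ hβ' hp hq hpq)).trans
      (hh.2 (Set.mem_univ _) (Set.mem_univ _) hp hq hpq)

theorem Game.continuous_loss {n : ℕ} (G : Game d n) (t : Fin n) : Continuous (G.loss t) :=
  continuousOn_univ.1 ((G.convexOn_loss t).continuousOn isOpen_univ)

/-! ### Subgradients of the non-strategic losses -/

/-- Shrinking a point of `K` by the factor `1 - s` makes room for a ball of radius `s` in `K`. -/
theorem closedBall_smul_subset {K : Set (E d)} (hKc : Convex ℝ K)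
    (hKb : Metric.closedBall 0 1 ⊆ K) {b : E d} (hb : b ∈ K) {s : ℝ} (hs : 0 ≤ s) (hs1 : s ≤ 1) :
    Metric.closedBall ((1 - s) • b) s ⊆ K := by
  intro y hy
  rcases hs.eq_or_lt with rfl | hs
  · have : y = b := by simpa using hy
    rwa [this]
  have hv : s⁻¹ • (y - (1 - s) • b) ∈ K := by
    refine hKb ?_
    rw [mem_closedBall_zero_iff, norm_smul, norm_inv, Real.norm_eq_abs, abs_of_pos hs,
      inv_mul_le_one₀ hs, ← dist_eq_norm]
    exact hy
  have := hKc hb hv (sub_nonneg.2 hs1) hs.le (sub_add_cancel _ _)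
  rwa [smul_smul, mul_inv_cancel₀ hs.ne', one_smul, add_sub_cancel] at this

theorem IsSubgradient.norm_le_of_closedBall_subset {c : E d → ℝ} {K : Set (E d)} {L ρ : ℝ}
    {p g : E d} (hg : IsSubgradient c p g) (hρ : 0 < ρ) (hK : Metric.closedBall p ρ ⊆ K)
    (hL0 : 0 ≤ L) (hL : ∀ β ∈ K, ∀ β' ∈ K, |c β - c β'| ≤ L * ‖β - β'‖) : ‖g‖ ≤ L := by
  rcases eq_or_ne g 0 with rfl | hg0
  · simpa using hL0
  have hgn : 0 < ‖g‖ := norm_pos_iff.2 hg0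
  set v := (ρ / ‖g‖) • g
  have hv : ‖v‖ = ρ := by
    simp [v, norm_smul, abs_of_pos hρ, hgn.ne']
  have hin : inner ℝ g v = ρ * ‖g‖ := by
    simp only [v, inner_smul_right, real_inner_self_eq_norm_sq]
    field_simp
  have h1 := hg (p + v)
  have h2 := (abs_le.1 (hL (p + v) (hK (by simp [hv])) p
    (hK (Metric.mem_closedBall_self hρ.le)))).2
  rw [add_sub_cancel_left, hin] at h1
  rw [add_sub_cancel_left, hv] at h2
  have : ρ * ‖g‖ ≤ ρ * L := by linarith
  exact le_of_mul_le_mul_left this hρ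

theorem isSubgradient_comp_inner {h : ℝ → ℝ} {h' : ℝ} (hconv : ConvexOn ℝ Set.univ h)
    {x p : E d} (hder : HasDerivAt h h' (inner ℝ x p)) :
    IsSubgradient (fun β => h (inner ℝ x β)) p (h' • x) := by
  intro z
  have hz : inner ℝ (h' • x) (z - p) = h' * (inner ℝ x z - inner ℝ x p) := by
    rw [inner_smul_left, inner_sub_right]
    rfl
  rw [hz]
  rcases lt_trichotomy (inner ℝ x p) (inner ℝ x z) with hlt | heq | hgt
  · have := hconv.le_slope_of_hasDerivAt (Set.mem_univ _) (Set.mem_univ _) hlt hder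
    rw [slope_def_field, le_div_iff₀ (by linarith)] at this
    linarith
  · simp [heq]
  · have := hconv.slope_le_of_hasDerivAt (Set.mem_univ _) (Set.mem_univ _) hgt hder
    rw [slope_def_field, div_le_iff₀ (by linarith)] at this
    linarith

theorem IsSubgradient.eq_of_hasDerivAt_comp_inner {h : ℝ → ℝ} {h' : ℝ} {x p g : E d}
    (hder : HasDerivAt h h' (inner ℝ x p))
    (hg : IsSubgradient (fun β => h (inner ℝ x β)) p g) : g = h' • x := by
  have hline : HasDerivAt (fun e : ℝ => inner ℝ x p + e * inner ℝ x (g - h' • x))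
      (inner ℝ x (g - h' • x)) 0 := by
    simpa using ((hasDerivAt_id (0 : ℝ)).mul_const (inner ℝ x (g - h' • x))).const_add
      (inner ℝ x p)
  have hcomp : HasDerivAt (fun e : ℝ => h (inner ℝ x p + e * inner ℝ x (g - h' • x)))
      (h' * inner ℝ x (g - h' • x)) 0 :=
    HasDerivAt.comp (0 : ℝ) (by simpa using hder) hline
  have hdiff := hcomp.sub ((hasDerivAt_id (0 : ℝ)).mul_const (inner ℝ g (g - h' • x)))
  have hmin : IsLocalMin ((fun e : ℝ => h (inner ℝ x p + e * inner ℝ x (g - h' • x))) -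
      fun e : ℝ => id e * inner ℝ g (g - h' • x)) 0 := by
    refine .of_forall fun e => ?_
    have := hg (p + e • (g - h' • x))
    simp only [add_sub_cancel_left, inner_add_right, inner_smul_right] at this
    simp only [Pi.sub_apply, id, zero_mul, add_zero, sub_zero]
    linarith
  have h0 := hmin.hasDerivAt_eq_zero hdiff
  have h1 : inner ℝ (g - h' • x) (g - h' • x) = 0 := by
    rw [inner_sub_left, inner_smul_left]
    simp only [conj_trivial]
    linarith
  exact sub_eq_zero.1 (inner_self_eq_zero.1 h1)

/-- A subgradient, at a point of `K`, of a loss of a linear score is bounded by the Lipschitz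
constant *on `K`*. For a general convex function this fails at boundary points of `K`, beyond which
the function may be steeper; here either the gradient is continuous (logistic), or `‖x‖ ≤ L` because
`K` contains the unit ball (hinge). -/
theorem IsSubgradient.norm_le_of_linear_score (k : LossKind) {x β g : E d} {K : Set (E d)} {L : ℝ}
    (hKc : Convex ℝ K) (hKb : Metric.closedBall 0 1 ⊆ K)
    (hL : ∀ b ∈ K, ∀ b' ∈ K, |k.h (inner ℝ x b) - k.h (inner ℝ x b')| ≤ L * ‖b - b'‖)
    (hL0 : 0 ≤ L)
    (hβ : β ∈ K) (hg : IsSubgradient (fun b => k.h (inner ℝ x b)) β g) : ‖g‖ ≤ L := by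
  cases k with
  | logistic =>
    set D : ℝ → ℝ := fun z => -(1 + Real.exp z)⁻¹ with hD
    have hder : ∀ z, HasDerivAt LossKind.logistic.h (D z) z := hasDerivAt_log_one_add_exp_neg
    rw [hg.eq_of_hasDerivAt_comp_inner (hder _)]
    have hDc : Continuous D := by
      refine Continuous.neg (Continuous.inv₀ (by fun_prop) fun z => ?_)
      positivity
    have hlim : Filter.Tendsto (fun s : ℝ => ‖D (inner ℝ x ((1 - s) • β)) • x‖)
        (nhdsWithin 0 (Set.Ioi 0)) (nhds ‖D (inner ℝ x β) • x‖) := by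
      have : Continuous fun s : ℝ => ‖D (inner ℝ x ((1 - s) • β)) • x‖ := by fun_prop
      simpa using (this.tendsto 0).mono_left nhdsWithin_le_nhds
    refine le_of_tendsto hlim ?_
    filter_upwards [Ioo_mem_nhdsGT (zero_lt_one' ℝ)] with s hs
    exact (isSubgradient_comp_inner LossKind.logistic.convexOn_h
      (hder _)).norm_le_of_closedBall_subset hs.1
        (closedBall_smul_subset hKc hKb hβ hs.1.le hs.2.le) hL0 hL
  | hinge =>
    have hx : ‖x‖ ≤ L := by
      rcases eq_or_ne x 0 with rfl | hx0
      · simpa using hL0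
      have hxn : 0 < ‖x‖ := norm_pos_iff.2 hx0
      have hv : ‖-(‖x‖⁻¹ • x)‖ = 1 := by
        rw [norm_neg, norm_smul, norm_inv, norm_norm, inv_mul_cancel₀ hxn.ne']
      have hin : inner ℝ x (-(‖x‖⁻¹ • x)) = -‖x‖ := by
        rw [inner_neg_right, inner_smul_right, real_inner_self_eq_norm_sq]
        field_simp
      have hmem : -(‖x‖⁻¹ • x) ∈ Metric.closedBall (0 : E d) 1 := by
        rw [mem_closedBall_zero_iff, hv]
      have := (abs_le.1 (hL _ (hKb hmem) 0 (hKb (by simp)))).2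
      rw [sub_zero, hv, hin, inner_zero_right] at this
      simp only [LossKind.h] at this
      rw [max_eq_right (by linarith), max_eq_right (by norm_num)] at this
      linarith
    refine le_trans ?_ hx
    have h1 := hg (β + g)
    simp only [LossKind.h, add_sub_cancel_left, inner_add_right, real_inner_self_eq_norm_sq] at h1
    have h2 := abs_le.1 (abs_real_inner_le_norm x g)
    have h3 : max 0 (1 - (inner ℝ x β + inner ℝ x g)) ≤
        max 0 (1 - inner ℝ x β) + ‖x‖ * ‖g‖ := by
      have : 0 ≤ ‖x‖ * ‖g‖ := by positivity
      refine max_le ?_ ?_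
      · linarith [le_max_left 0 (1 - inner ℝ x β)]
      · linarith [le_max_right 0 (1 - inner ℝ x β), h2.1]
    rcases (norm_nonneg g).eq_or_lt with h0 | h0
    · rw [← h0]
      positivity
    · nlinarith

end

/-! ### The one-point gradient estimate -/

/-- In conditional expectation, the one-point gradient estimate `(d / δ) c(β + δ S) S` is a
subgradient of `c` at `β` up to the error `2 L δ` made by smoothing `c` at radius `δ`. -/
theorem sub_le_integral_sphereUniform {d : ℕ} (hd : 0 < d) {c : E d → ℝ}
    (hc : ConvexOn ℝ Set.univ c) {K : Set (E d)} {L δ : ℝ} (hL0 : 0 ≤ L) (hδ : 0 < δ)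
    (hL : ∀ b ∈ K, ∀ b' ∈ K, |c b - c b'| ≤ L * ‖b - b'‖) {β u : E d}
    (hβ : Metric.closedBall β δ ⊆ K) (hu : Metric.closedBall u δ ⊆ K) :
    c β - c u - 2 * (L * δ) ≤ ∫ s, ((d : ℝ) / δ * c (β + δ • (s : E d))) *
      inner ℝ (s : E d) (β - u) ∂sphereUniform d := by
  have : Nonempty (Fin d) := ⟨⟨0, hd⟩⟩
  set w : E d := δ⁻¹ • (u - β) with hw
  set F : E d → ℝ := fun x => c (β + δ • x) with hF
  have hFc : ConvexOn ℝ Set.univ F := by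
    refine ⟨convex_univ, fun x _ y _ p q hp hq hpq => ?_⟩
    have h := hc.2 (Set.mem_univ (β + δ • x)) (Set.mem_univ (β + δ • y)) hp hq hpq
    have hx : p • (β + δ • x) + q • (β + δ • y) = β + δ • (p • x + q • y) := by
      have : β = (p + q) • β := by rw [hpq, one_smul]
      nth_rewrite 3 [this]
      module
    rwa [hx] at h
  have hFcont : Continuous F := continuousOn_univ.1 (hFc.continuousOn isOpen_univ)
  have hw' : ∀ x, F (x + w) = c (u + δ • x) := by
    intro x
    simp only [hF, hw, smul_add, smul_smul, mul_inv_cancel₀ hδ.ne', one_smul]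
    congr 1
    abel
  have hnear : ∀ (b : E d), Metric.closedBall b δ ⊆ K → ∀ x ∈ Metric.ball (0 : E d) 1,
      |c (b + δ • x) - c b| ≤ L * δ := by
    intro b hb x hx
    have hx1 : ‖δ • x‖ ≤ δ := by
      rw [norm_smul, Real.norm_eq_abs, abs_of_pos hδ]
      have : ‖x‖ < 1 := by simpa using hx
      nlinarith
    refine (hL _ (hb (by simpa using hx1)) _ (hb (Metric.mem_closedBall_self hδ.le))).trans ?_
    rw [add_sub_cancel_left]
    gcongr
  have hint : ∀ v : E d, IntegrableOn (fun x => F (x + v)) (Metric.ball (0 : E d) 1) volume :=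
    fun v => ((by fun_prop : Continuous fun x => F (x + v)).continuousOn.integrableOn_compact
      (isCompact_closedBall _ _)).mono_set Metric.ball_subset_closedBall
  set vol := (volume : Measure (E d)).real (Metric.ball (0 : E d) 1) with hvol
  have hvolpos : 0 < vol := 
    ENNReal.toReal_pos (Metric.measure_ball_pos _ _ one_pos).ne' measure_ball_lt_top.ne
  have hdiv : ∫ s : Metric.sphere (0 : E d) 1, F s * inner ℝ w (s : E d)
      ∂(volume : Measure (E d)).toSphere ≤ vol * (c u - c β + 2 * (L * δ)) := by
    refine (integral_toSphere_mul_inner_le volume hFc w).trans ?_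
    have h0 : IntegrableOn F (Metric.ball (0 : E d) 1) volume := by simpa using hint 0
    rw [← integral_sub (hint w) h0]
    calc _ ≤ ∫ x in Metric.ball (0 : E d) 1, (c u - c β + 2 * (L * δ)) := by
          refine setIntegral_mono_on ((hint w).sub h0)
            (integrableOn_const measure_ball_lt_top.ne) measurableSet_ball fun x hx => ?_
          have h1 := abs_le.1 (hnear u hu x hx)
          have h2 := abs_le.1 (hnear β hβ x hx)
          rw [hw']
          simp only [hF]
          linarith
      _ = _ := by simp [hvol]
  have hscale : ∀ s : Metric.sphere (0 : E d) 1,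
      ((d : ℝ) / δ * c (β + δ • (s : E d))) * inner ℝ (s : E d) (β - u) =
        (-(d : ℝ)) * (F s * inner ℝ w (s : E d)) := by
    intro s
    have : inner ℝ w (s : E d) = -(δ⁻¹ * inner ℝ (s : E d) (β - u)) := by
      rw [hw, inner_smul_left, real_inner_comm, ← neg_sub β u, inner_neg_right]
      simp
    rw [this]
    simp only [hF]
    ring
  simp only [hscale]
  rw [sphereUniform, integral_smul_measure, integral_const_mul, Measure.toSphere_apply_univ,
    ENNReal.toReal_inv, ENNReal.toReal_mul, finrank_euclideanSpace_fin, smul_eq_mul]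
  have hdpos : (0 : ℝ) < d := by exact_mod_cast hd
  change _ ≤ ((d : ENNReal).toReal * vol)⁻¹ * _
  rw [ENNReal.toReal_natCast]
  set I := ∫ s : Metric.sphere (0 : E d) 1, F s * inner ℝ w (s : E d)
      ∂(volume : Measure (E d)).toSphere
  have : ((d : ℝ) * vol)⁻¹ * (-(d : ℝ) * I) = -(I / vol) := by
    field_simp
  rw [this]
  have h2 : I / vol ≤ c u - c β + 2 * (L * δ) := by
    rw [div_le_iff₀ hvolpos]
    linarith
  linarith

/-- A lower bound for the conditional mean of `Ψ (X, Y)` given `X = a`, where `Y` is independent of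
`X`, integrates to a lower bound for the mean. It is only needed on a set `A` containing `X`. -/
theorem integral_le_integral_of_indepFun {Ω α β : Type*} [MeasurableSpace Ω] [MeasurableSpace α]
    [MeasurableSpace β] {P : Measure Ω} [IsProbabilityMeasure P] {X : Ω → α} {Y : Ω → β}
    (hX : Measurable X) (hY : Measurable Y) (hXY : IndepFun X Y P) {A : Set α}
    (hA : MeasurableSet A) (hXA : ∀ ω, X ω ∈ A) {φ : α → ℝ} (hφm : Measurable φ)
    (hφ : Integrable (fun ω => φ (X ω)) P) {Ψ : α × β → ℝ} (hΨm : Measurable Ψ)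
    (hΨ : Integrable (fun ω => Ψ (X ω, Y ω)) P)
    (hle : ∀ a ∈ A, φ a ≤ ∫ y, Ψ (a, y) ∂P.map Y) :
    ∫ ω, φ (X ω) ∂P ≤ ∫ ω, Ψ (X ω, Y ω) ∂P := by
  have := Measure.isProbabilityMeasure_map (μ := P) hX.aemeasurable
  have := Measure.isProbabilityMeasure_map (μ := P) hY.aemeasurable
  have hprod := (indepFun_iff_map_prod_eq_prod_map_map hX.aemeasurable hY.aemeasurable).1 hXY
  have hΨint : Integrable Ψ ((P.map X).prod (P.map Y)) := by
    rw [← hprod, integrable_map_measure hΨm.aestronglyMeasurable (hX.prodMk hY).aemeasurable]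
    exact hΨ
  have hφint : Integrable φ (P.map X) :=
    (integrable_map_measure hφm.aestronglyMeasurable hX.aemeasurable).2 hφ
  calc ∫ ω, φ (X ω) ∂P = ∫ a, φ a ∂P.map X :=
        (integral_map hX.aemeasurable hφm.aestronglyMeasurable).symm
    _ ≤ ∫ a, ∫ y, Ψ (a, y) ∂P.map Y ∂P.map X :=
        integral_mono_ae hφint hΨint.integral_prod_left
          (((ae_map_iff hX.aemeasurable hA).2 (.of_forall hXA)).mono fun a ha => hle a ha)
    _ = ∫ p, Ψ p ∂(P.map X).prod (P.map Y) := (integral_prod _ hΨint).symm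
    _ = ∫ ω, Ψ (X ω, Y ω) ∂P := by
        rw [← hprod, integral_map (hX.prodMk hY).aemeasurable hΨm.aestronglyMeasurable]

/-! ### Projected gradient steps -/

theorem IsProjection.norm_sub_le {d : ℕ} {A : Set (E d)} (hA : Convex ℝ A) {p q u : E d}
    (h : IsProjection A p q) (hu : u ∈ A) : ‖q - u‖ ≤ ‖p - u‖ := by
  have hinf : ‖p - q‖ = ⨅ w : A, ‖p - w‖ := by
    have : Nonempty A := ⟨⟨q, h.1⟩⟩
    refine le_antisymm (le_ciInf fun w => h.2 w w.2) ?_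
    exact ciInf_le ⟨0, by rintro _ ⟨w, rfl⟩; exact norm_nonneg _⟩ (⟨q, h.1⟩ : A)
  have hin := (norm_eq_iInf_iff_real_inner_le_zero hA h.1).1 hinf u hu
  have hsq : ‖p - u‖ ^ 2 = ‖p - q‖ ^ 2 + ‖q - u‖ ^ 2 - 2 * inner ℝ (p - q) (u - q) := by
    rw [← norm_sub_rev u q, show p - u = (p - q) - (u - q) by abel, norm_sub_sq_real]
    ring
  have : ‖q - u‖ ^ 2 ≤ ‖p - u‖ ^ 2 := by nlinarith [sq_nonneg ‖p - q‖]
  exact le_of_sq_le_sq this (norm_nonneg _)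

theorem IsProjection.two_mul_inner_le {d : ℕ} {A : Set (E d)} (hA : Convex ℝ A) {β g q u : E d}
    {η : ℝ} (h : IsProjection A (β - η • g) q) (hu : u ∈ A) :
    2 * η * inner ℝ g (β - u) ≤ ‖β - u‖ ^ 2 - ‖q - u‖ ^ 2 + η ^ 2 * ‖g‖ ^ 2 := by
  have h1 := h.norm_sub_le hA hu
  have h2 : ‖β - η • g - u‖ ^ 2 = ‖β - u‖ ^ 2 - 2 * η * inner ℝ g (β - u) + η ^ 2 * ‖g‖ ^ 2 := by
    rw [show β - η • g - u = (β - u) - η • g by abel, norm_sub_sq_real, inner_smul_right,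
      real_inner_comm, norm_smul, mul_pow, Real.norm_eq_abs, sq_abs]
    ring
  have h3 : ‖q - u‖ ^ 2 ≤ ‖β - η • g - u‖ ^ 2 := by gcongr
  linarith

/-! ### Parameters of an admissible game -/

variable {d n : ℕ} {G : Game d n} {M L R : ℝ}

theorem Game.theta_nonneg : 0 ≤ G.theta := by
  unfold Game.theta
  positivity

theorem Game.theta_le_one : G.theta ≤ 1 := by
  refine div_le_one_of_le₀ ?_ (Nat.cast_nonneg n)
  exact_mod_cast (Finset.card_filter_le _ _).trans (by simp)

theorem Game.sum_ite_strategic (hn : 0 < n) (a b : ℝ) :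
    ∑ t, (if (G.agent t).y = -1 then a else b) = n * (G.theta * a + (1 - G.theta) * b) := by
  have hn' : (n : ℝ) ≠ 0 := by exact_mod_cast hn.ne'
  have hcard := Finset.card_filter_add_card_filter_not (s := (Finset.univ : Finset (Fin n)))
    fun t => (G.agent t).y = -1
  rw [Finset.card_univ, Fintype.card_fin] at hcard
  have hcard' : (((Finset.univ : Finset (Fin n)).filter fun t => ¬(G.agent t).y = -1).card : ℝ) =
      n - ((Finset.univ : Finset (Fin n)).filter fun t => (G.agent t).y = -1).card := by
    rw [eq_sub_iff_add_eq, add_comm]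
    exact_mod_cast hcard
  rw [Finset.sum_ite, Finset.sum_const, Finset.sum_const, nsmul_eq_mul, nsmul_eq_mul, hcard',
    Game.theta]
  field_simp

theorem Game.theta_pos_of_strategic {t : Fin n} (ht : (G.agent t).y = -1) : 0 < G.theta := by
  have hn : (0 : ℝ) < n := by exact_mod_cast t.pos
  refine div_pos ?_ hn
  exact_mod_cast Finset.card_pos.2 ⟨t, by simp [ht]⟩

theorem Game.delta_nonneg : 0 ≤ G.delta M L R := by
  have := G.theta_nonneg
  unfold Game.delta
  positivity

theorem Game.zero_mem : (0 : E d) ∈ G.K := G.unitBall (by simp)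

namespace Game.Admissible

theorem one_le_R (hG : G.Admissible M L R) : 1 ≤ R := by
  have h := hG.norm_le (EuclideanSpace.single ⟨0, hG.dim_pos⟩ 1) (G.unitBall (by simp))
  simpa using h

theorem delta_pos (hG : G.Admissible M L R) (hθ : 0 < G.theta) : 0 < G.delta M L R := by
  have h1 := hG.M_pos
  have h2 := hG.L_pos
  have h3 := hG.one_le_R
  have h4 : (0 : ℝ) < d := by exact_mod_cast hG.dim_pos
  have h5 : (0 : ℝ) < n := by exact_mod_cast hG.rounds_pos
  unfold Game.delta
  positivity

theorem closedBall_subset (hG : G.Admissible M L R) {β : E d}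
    (hβ : β ∈ G.shrink (G.delta M L R)) : Metric.closedBall β (G.delta M L R) ⊆ G.K := by
  obtain ⟨b, hb, rfl⟩ := hβ
  exact closedBall_smul_subset G.convex G.unitBall hb G.delta_nonneg hG.delta_le

theorem mem_of_mem_shrink (hG : G.Admissible M L R) {β : E d}
    (hβ : β ∈ G.shrink (G.delta M L R)) : β ∈ G.K :=
  hG.closedBall_subset hβ (Metric.mem_closedBall_self G.delta_nonneg)

theorem isCompact_shrink (hG : G.Admissible M L R) (δ : ℝ) : IsCompact (G.shrink δ) := by
  have : IsCompact G.K := Metric.isCompact_of_isClosed_isBounded G.closed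
    ((Metric.isBounded_closedBall (x := (0 : E d)) (r := R)).subset fun b hb => by
      simpa using hG.norm_le b hb)
  exact this.image (by fun_prop)

end Game.Admissible

theorem Game.convex_shrink (δ : ℝ) : Convex ℝ (G.shrink δ) := G.convex.smul (1 - δ)

/-- The radius `δ` balances the smoothing error `n L δ (R + 3)` against the variance term. -/
theorem Game.Admissible.smoothing_error_eq (hG : G.Admissible M L R) :
    n * (L * G.delta M L R * (R + 3)) =
      (n : ℝ) ^ (3 / 4 : ℝ) * Real.sqrt (d * M * L * R * (R + 3)) * G.theta ^ (1 / 4 : ℝ) := by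
  have hM := hG.M_pos
  have hL := hG.L_pos
  have hR := hG.one_le_R
  have hn : (0 : ℝ) < n := by exact_mod_cast hG.rounds_pos
  have h1 : Real.sqrt (d * M * R / (L * (R + 3))) =
      Real.sqrt (d * M * L * R * (R + 3)) / (L * (R + 3)) := by
    rw [← Real.sqrt_sq (show 0 ≤ L * (R + 3) by positivity), ← Real.sqrt_div' _ (by positivity),
      Real.sqrt_sq (by positivity)]
    congr 1
    field_simp
  have h2 : (n : ℝ) ^ (3 / 4 : ℝ) = n * (n : ℝ) ^ (-(1 / 4) : ℝ) := by
    rw [← Real.rpow_one_add' hn.le (by norm_num)]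
    norm_num
  rw [Game.delta, h1, h2]
  field_simp

theorem Game.Admissible.variance_term_eq (hG : G.Admissible M L R) :
    R * (Real.sqrt (n * G.theta) * (d * M / G.delta M L R)) =
      (n : ℝ) ^ (3 / 4 : ℝ) * Real.sqrt (d * M * L * R * (R + 3)) * G.theta ^ (1 / 4 : ℝ) := by
  rcases G.theta_nonneg.eq_or_lt with hθ | hθ
  · simp [← hθ]
  have hδ := hG.delta_pos hθ
  have hM := hG.M_pos
  have hL := hG.L_pos
  have hR := hG.one_le_R
  have hn : (0 : ℝ) < n := by exact_mod_cast hG.rounds_pos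
  have hd : (0 : ℝ) < d := by exact_mod_cast hG.dim_pos
  -- Multiplied by `n L δ (R + 3)`, both sides become `n √(n θ) d M L R (R + 3)`.
  have hS := hG.smoothing_error_eq
  have hSpos : 0 < n * (L * G.delta M L R * (R + 3)) := by positivity
  refine mul_right_cancel₀ hSpos.ne' ?_
  nth_rewrite 2 [hS]
  have hq : Real.sqrt (d * M * L * R * (R + 3)) ^ 2 = d * M * L * R * (R + 3) :=
    Real.sq_sqrt (by positivity)
  have hp : (G.theta ^ (1 / 4 : ℝ)) ^ 2 = Real.sqrt G.theta := by
    rw [← Real.rpow_natCast, ← Real.rpow_mul hθ.le, Real.sqrt_eq_rpow]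
    norm_num
  have hm : ((n : ℝ) ^ (3 / 4 : ℝ)) ^ 2 = n * Real.sqrt n := by
    rw [← Real.rpow_natCast, ← Real.rpow_mul hn.le, Real.sqrt_eq_rpow,
      ← Real.rpow_one_add' hn.le (by norm_num)]
    norm_num
  rw [Real.sqrt_mul hn.le]
  calc _ = (n * Real.sqrt n) * (d * M * L * R * (R + 3)) * Real.sqrt G.theta := by
        field_simp
    _ = _ := by
        rw [← hp, ← hm]
        linear_combination -((n : ℝ) ^ (3 / 4 : ℝ)) ^ 2 * (G.theta ^ (1 / 4 : ℝ)) ^ 2 * hq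

theorem sqrt_add_le_sqrt_add_sqrt {a b : ℝ} (ha : 0 ≤ a) (hb : 0 ≤ b) :
    Real.sqrt (a + b) ≤ Real.sqrt a + Real.sqrt b := by
  refine Real.sqrt_le_iff.2 ⟨by positivity, ?_⟩
  nlinarith [Real.sq_sqrt ha, Real.sq_sqrt hb, Real.sqrt_nonneg a, Real.sqrt_nonneg b]

/-! ### Runs of the algorithm -/

namespace Run

variable {Ω : Type u} [mΩ : MeasurableSpace Ω] {P : Measure Ω} (run : Run G M L R P)

theorem β_mem_shrink (ω : Ω) : ∀ t : ℕ, t ≤ n → run.β t ω ∈ G.shrink (G.delta M L R)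
  | 0, _ => by
    rw [run.init]
    exact run.start_mem
  | t + 1, ht => (run.update ⟨t, ht⟩ ω).1

theorem deployed_mem (hG : G.Admissible M L R) (t : Fin n) (ω : Ω) :
    run.deployed t ω ∈ G.K := by
  refine hG.closedBall_subset (run.β_mem_shrink ω t t.2.le) ?_
  simp [deployed, norm_smul, abs_of_nonneg G.delta_nonneg]

theorem iterate_mem (hG : G.Admissible M L R) (t : Fin n) (ω : Ω) : run.iterate t ω ∈ G.K :=
  hG.mem_of_mem_shrink (run.β_mem_shrink ω t t.2.le)

theorem measurable_iterate (t : Fin n) : Measurable (run.iterate t) :=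
  (run.β_measurable t).mono (run.history.le _) le_rfl

theorem measurable_S (t : Fin n) : Measurable (run.S t) :=
  (run.S_measurable t).mono (run.history.le _) le_rfl

theorem measurable_deployed (t : Fin n) : Measurable (run.deployed t) :=
  (run.measurable_iterate t).add
    ((measurable_subtype_coe.comp (run.measurable_S t)).const_smul (G.delta M L R))

theorem indepFun_iterate_S (t : Fin n) : IndepFun (run.iterate t) (run.S t) P := by
  rw [IndepFun_iff_Indep]
  exact indep_of_indep_of_le_left (run.S_indep t).symm (run.β_measurable t).comap_le

theorem loss_deployed_le (hG : G.Admissible M L R) (t : Fin n) (ω : Ω) :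
    G.loss t (run.deployed t ω) ≤ G.loss t (run.iterate t ω) + L * G.delta M L R := by
  have h := hG.lipschitz t _ (run.deployed_mem hG t ω) _ (run.iterate_mem hG t ω)
  have hnorm : ‖run.deployed t ω - run.iterate t ω‖ = G.delta M L R := by
    simp [deployed, iterate, norm_smul, abs_of_nonneg G.delta_nonneg]
  rw [hnorm] at h
  linarith [(abs_le.1 h).2]

/-- The part of the regret against `u` in round `t` that projected gradient descent controls: the
linearization `⟪g_t, β_t - u⟫` in a strategic round and the regret itself in a non-strategic one.
In this form it is measurable although the choice of the subgradients need not be. -/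
noncomputable def linearized (v : E d) (t : Fin n) (ω : Ω) : ℝ :=
  if (G.agent t).y = -1 then
    ((d : ℝ) / G.delta M L R * G.loss t (run.deployed t ω)) *
      inner ℝ (run.S t ω : E d) (run.iterate t ω - v)
  else G.loss t (run.iterate t ω) - G.loss t v

theorem linearized_le_inner (v : E d) (t : Fin n) (ω : Ω) :
    run.linearized v t ω ≤ inner ℝ (run.g t ω) (run.iterate t ω - v) := by
  unfold linearized
  split_ifs with hy
  · rw [run.g_strategic t hy ω, inner_smul_left]
    rfl
  · have h := run.g_nonstrategic t ((G.agent t).label.resolve_right hy) ω v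
    rw [← neg_sub v, inner_neg_right]
    simp only [iterate]
    linarith

theorem norm_g_sq_le (hG : G.Admissible M L R) (t : Fin n) (ω : Ω) :
    ‖run.g t ω‖ ^ 2 ≤
      if (G.agent t).y = -1 then (d : ℝ) ^ 2 * M ^ 2 / G.delta M L R ^ 2 else L ^ 2 := by
  split_ifs with hy
  · rw [run.g_strategic t hy ω, norm_smul, norm_eq_of_mem_sphere, mul_one, norm_mul, mul_pow,
      Real.norm_eq_abs, Real.norm_eq_abs, sq_abs, div_pow, div_mul_eq_mul_div]
    have := hG.loss_le t _ (run.deployed_mem hG t ω)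
    simp only [deployed] at this
    gcongr
  · have hy' := (G.agent t).label.resolve_right hy
    have hloss : G.loss t = fun b => G.kind.h (inner ℝ (G.agent t).x b) := by
      funext b
      simp [Game.loss, LossKind.c, hy', (G.isResponse t).2 hy' b]
    have hg := run.g_nonstrategic t hy' ω
    have hlip := hG.lipschitz t
    rw [hloss] at hg hlip
    have := hg.norm_le_of_linear_score G.kind G.convex G.unitBall hlip hG.L_pos.le
      (run.iterate_mem hG t ω)
    gcongr

theorem sum_linearized_le (hG : G.Admissible M L R) {v : E d}
    (hv : v ∈ G.shrink (G.delta M L R)) (ω : Ω) :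
    ∑ t, run.linearized v t ω ≤ R * Real.sqrt (n * (G.theta *
      ((d : ℝ) ^ 2 * M ^ 2 / G.delta M L R ^ 2) + (1 - G.theta) * L ^ 2)) := by
  set A := n * (G.theta * ((d : ℝ) ^ 2 * M ^ 2 / G.delta M L R ^ 2) + (1 - G.theta) * L ^ 2)
    with hA
  set Γ : Fin n → ℝ := fun t =>
    if (G.agent t).y = -1 then (d : ℝ) ^ 2 * M ^ 2 / G.delta M L R ^ 2 else L ^ 2 with hΓ
  have hsumΓ : ∑ t, Γ t = A := G.sum_ite_strategic hG.rounds_pos _ _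
  have hApos : 0 < A := by
    rw [← hsumΓ]
    have : Nonempty (Fin n) := ⟨⟨0, hG.rounds_pos⟩⟩
    refine Finset.sum_pos (fun t _ => ?_) Finset.univ_nonempty
    simp only [hΓ]
    split_ifs with hy
    · have := hG.delta_pos (G.theta_pos_of_strategic hy)
      have := hG.M_pos
      have : (0 : ℝ) < d := by exact_mod_cast hG.dim_pos
      positivity
    · have := hG.L_pos
      positivity
  have hRpos : 0 < R := one_pos.trans_le hG.one_le_R
  set η := G.eta M L R with hη
  have hη' : η = R / Real.sqrt A := rfl
  have hsA : 0 < Real.sqrt A := Real.sqrt_pos.2 hApos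
  have hηpos : 0 < η := div_pos hRpos hsA
  have hstep : ∀ t : Fin n, 2 * η * run.linearized v t ω ≤
      (‖run.β t ω - v‖ ^ 2 - ‖run.β (t + 1) ω - v‖ ^ 2) + η ^ 2 * Γ t := by
    intro t
    have h1 := (run.update t ω).two_mul_inner_le (G.convex_shrink _) hv
    have h2 : 2 * η * run.linearized v t ω ≤ 2 * η * inner ℝ (run.g t ω) (run.β t ω - v) :=
      mul_le_mul_of_nonneg_left (run.linearized_le_inner v t ω) (by positivity)
    have h3 : η ^ 2 * ‖run.g t ω‖ ^ 2 ≤ η ^ 2 * Γ t :=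
      mul_le_mul_of_nonneg_left (run.norm_g_sq_le hG t ω) (by positivity)
    linarith
  have hsum := Finset.sum_le_sum fun t (_ : t ∈ Finset.univ) => hstep t
  rw [← Finset.mul_sum, Finset.sum_add_distrib, ← Finset.mul_sum, hsumΓ,
    Fin.sum_univ_eq_sum_range (fun i => ‖run.β i ω - v‖ ^ 2 - ‖run.β (i + 1) ω - v‖ ^ 2) n,
    Finset.sum_range_sub'] at hsum
  have hstart : ‖run.β 0 ω - v‖ ^ 2 ≤ R ^ 2 := by
    rw [run.init, norm_sub_rev]
    have := run.start_dist v (hG.mem_of_mem_shrink hv)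
    gcongr
  have hfin : 2 * η * ∑ t, run.linearized v t ω ≤ 2 * η * (R * Real.sqrt A) := by
    have h1 : η ^ 2 * A = R ^ 2 := by
      rw [hη', div_pow, Real.sq_sqrt hApos.le]
      field_simp
    have h2 : 2 * η * (R * Real.sqrt A) = 2 * R ^ 2 := by
      rw [hη']
      field_simp
    rw [h2]
    linarith [sq_nonneg ‖run.β n ω - v‖]
  exact le_of_mul_le_mul_left hfin (by positivity)

theorem measurable_linearized (v : E d) (t : Fin n) : Measurable (run.linearized v t) := by
  have h1 := (G.continuous_loss t).measurable.comp (run.measurable_deployed t)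
  have h2 := (G.continuous_loss t).measurable.comp (run.measurable_iterate t)
  have h3 := measurable_subtype_coe.comp (run.measurable_S t)
  unfold linearized
  split_ifs
  · exact (h1.const_mul _).mul (h3.inner ((run.measurable_iterate t).sub_const v))
  · exact h2.sub_const _

variable [IsProbabilityMeasure P]

theorem integrable_loss (hG : G.Admissible M L R) {B : Ω → E d} (hB : Measurable B)
    (hK : ∀ ω, B ω ∈ G.K) (t : Fin n) : Integrable (fun ω => G.loss t (B ω)) P :=
  .of_bound ((G.continuous_loss t).measurable.comp hB).aestronglyMeasurable M
    (.of_forall fun ω => hG.loss_le t _ (hK ω))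

theorem integrable_linearized (hG : G.Admissible M L R) {v : E d} (hv : v ∈ G.K) (t : Fin n) :
    Integrable (run.linearized v t) P := by
  by_cases hy : (G.agent t).y = -1
  · refine .of_bound (run.measurable_linearized v t).aestronglyMeasurable
      ((d / G.delta M L R * M) * (R + R)) (.of_forall fun ω => ?_)
    have hδ := G.delta_nonneg (M := M) (L := L) (R := R)
    have h1 : |inner ℝ (run.S t ω : E d) (run.iterate t ω - v)| ≤ R + R := by
      refine (abs_real_inner_le_norm _ _).trans ?_
      rw [norm_eq_of_mem_sphere, one_mul]
      exact (norm_sub_le _ _).trans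
        (add_le_add (hG.norm_le _ (run.iterate_mem hG t ω)) (hG.norm_le _ hv))
    have h2 := hG.loss_le t _ (run.deployed_mem hG t ω)
    have hM := hG.M_pos
    rw [linearized, if_pos hy, norm_mul, norm_mul, Real.norm_eq_abs, Real.norm_eq_abs,
      Real.norm_eq_abs, abs_of_nonneg (by positivity : 0 ≤ (d : ℝ) / G.delta M L R)]
    gcongr
  · have : run.linearized v t = fun ω => G.loss t (run.iterate t ω) - G.loss t v := by
      funext ω
      simp [linearized, hy]
    rw [this]
    exact (integrable_loss hG (run.measurable_iterate t) (run.iterate_mem hG t) t).sub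
      (integrable_const _)

theorem integral_loss_iterate_sub_le (hG : G.Admissible M L R) {v : E d}
    (hv : v ∈ G.shrink (G.delta M L R)) (t : Fin n) :
    ∫ ω, G.loss t (run.iterate t ω) ∂P - G.loss t v - 2 * (L * G.delta M L R) ≤
      ∫ ω, run.linearized v t ω ∂P := by
  have hδ0 := G.delta_nonneg (M := M) (L := L) (R := R)
  have hL := hG.L_pos
  have hint := integrable_loss (P := P) hG (run.measurable_iterate t) (run.iterate_mem hG t) t
  have hsub : ∀ a : ℝ, ∫ ω, (G.loss t (run.iterate t ω) - a) ∂P =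
      ∫ ω, G.loss t (run.iterate t ω) ∂P - a := by
    intro a
    rw [integral_sub hint (integrable_const _)]
    simp
  by_cases hy : (G.agent t).y = -1
  · have hδ := hG.delta_pos (G.theta_pos_of_strategic hy)
    have hc := G.continuous_loss t
    rw [sub_sub, ← hsub]
    set Ψ : E d × Metric.sphere (0 : E d) 1 → ℝ := fun p =>
      ((d : ℝ) / G.delta M L R * G.loss t (p.1 + G.delta M L R • (p.2 : E d))) *
        inner ℝ (p.2 : E d) (p.1 - v) with hΨ
    have hΨc : Continuous Ψ := by fun_prop
    have hlin : ∀ ω, run.linearized v t ω = Ψ (run.iterate t ω, run.S t ω) := by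
      intro ω
      simp [hΨ, linearized, hy, deployed, iterate]
    have hlint := run.integrable_linearized hG (hG.mem_of_mem_shrink hv) t
    simp only [funext hlin] at hlint ⊢
    refine integral_le_integral_of_indepFun (X := run.iterate t) (Y := run.S t)
      (φ := fun b => G.loss t b - (G.loss t v + 2 * (L * G.delta M L R)))
      (run.measurable_iterate t) (run.measurable_S t) (run.indepFun_iterate_S t)
      (hG.isCompact_shrink (G.delta M L R)).measurableSet
      (fun ω => run.β_mem_shrink ω t t.2.le) (hc.measurable.sub_const _)
      (hint.sub (integrable_const _)) hΨc.measurable hlint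
      fun b hb => ?_
    rw [run.S_law t, ← sub_sub]
    exact sub_le_integral_sphereUniform hG.dim_pos (G.convexOn_loss t) hL.le hδ (hG.lipschitz t)
      (hG.closedBall_subset hb) (hG.closedBall_subset hv)
  · simp only [linearized, hy, if_false]
    rw [hsub]
    have : 0 ≤ L * G.delta M L R := by positivity
    linarith

/-- The comparator `b ∈ K` is first replaced by `(1 - δ) b`, at the price `L δ R` per round; each
round then loses `2 L δ` from smoothing and at most `L δ` from deploying the perturbed point. -/
theorem sum_integral_loss_sub_le (hG : G.Admissible M L R) {B : Fin n → Ω → E d}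
    (hB : B = run.deployed ∨ B = run.iterate) {b : E d} (hb : b ∈ G.K) :
    ∑ t, ∫ ω, G.loss t (B t ω) ∂P - ∑ t, G.loss t b ≤
      R * Real.sqrt (n * (G.theta * ((d : ℝ) ^ 2 * M ^ 2 / G.delta M L R ^ 2) +
        (1 - G.theta) * L ^ 2)) + n * (L * G.delta M L R * (R + 3)) := by
  have hδ0 := G.delta_nonneg (M := M) (L := L) (R := R)
  have hL := hG.L_pos
  set δ := G.delta M L R with hδ
  have hv : (1 - δ) • b ∈ G.shrink δ := ⟨b, hb, rfl⟩
  have hround : ∀ t, ∫ ω, G.loss t (B t ω) ∂P - G.loss t b ≤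
      ∫ ω, run.linearized ((1 - δ) • b) t ω ∂P + L * δ * (R + 3) := by
    intro t
    have h1 := run.integral_loss_iterate_sub_le hG hv t
    have h2 : G.loss t ((1 - δ) • b) ≤ G.loss t b + L * δ * R := by
      have h := (abs_le.1 (hG.lipschitz t _ (hG.mem_of_mem_shrink hv) b hb)).2
      have hnorm : ‖(1 - δ) • b - b‖ ≤ δ * R := by
        rw [show (1 - δ) • b - b = -(δ • b) by module, norm_neg, norm_smul, Real.norm_eq_abs,
          abs_of_nonneg hδ0]
        exact mul_le_mul_of_nonneg_left (hG.norm_le b hb) hδ0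
      have := mul_le_mul_of_nonneg_left hnorm hL.le
      linarith
    have h3 : ∫ ω, G.loss t (B t ω) ∂P ≤ ∫ ω, G.loss t (run.iterate t ω) ∂P + L * δ := by
      have hint := integrable_loss (P := P) hG (run.measurable_iterate t) (run.iterate_mem hG t) t
      rcases hB with rfl | rfl
      · have : ∫ ω, G.loss t (run.deployed t ω) ∂P ≤
            ∫ ω, (G.loss t (run.iterate t ω) + L * δ) ∂P :=
          integral_mono
            (integrable_loss hG (run.measurable_deployed t) (run.deployed_mem hG t) t)
            (hint.add (integrable_const _)) fun ω => run.loss_deployed_le hG t ω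
        rw [integral_add hint (integrable_const _)] at this
        simpa using this
      · have : 0 ≤ L * δ := by positivity
        linarith
    linarith
  have hpath : ∑ t, ∫ ω, run.linearized ((1 - δ) • b) t ω ∂P ≤
      R * Real.sqrt (n * (G.theta * ((d : ℝ) ^ 2 * M ^ 2 / δ ^ 2) + (1 - G.theta) * L ^ 2)) := by
    have hli := fun t => run.integrable_linearized hG (hG.mem_of_mem_shrink hv) t
    rw [← integral_finsetSum _ fun t _ => hli t]
    refine (integral_mono (integrable_finsetSum _ fun t _ => hli t) (integrable_const _)
      fun ω => run.sum_linearized_le hG hv ω).trans_eq ?_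
    rw [integral_const, probReal_univ, one_smul]
  have hsum := Finset.sum_le_sum fun t (_ : t ∈ Finset.univ) => hround t
  rw [Finset.sum_sub_distrib, Finset.sum_add_distrib, Finset.sum_const, Finset.card_univ,
    Fintype.card_fin, nsmul_eq_mul] at hsum
  linarith

theorem integrable_regret (hG : G.Admissible M L R) {B : Fin n → Ω → E d}
    (hB : B = run.deployed ∨ B = run.iterate) :
    Integrable (fun ω => G.regret fun t => B t ω) P := by
  refine (integrable_finsetSum _ fun t _ => ?_).sub (integrable_const _)
  rcases hB with rfl | rfl
  · exact integrable_loss hG (run.measurable_deployed t) (run.deployed_mem hG t) t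
  · exact integrable_loss hG (run.measurable_iterate t) (run.iterate_mem hG t) t

theorem expectedRegret_le (hG : G.Admissible M L R) {B : Fin n → Ω → E d}
    (hB : B = run.deployed ∨ B = run.iterate) :
    expectedRegret G P B ≤ L * R * Real.sqrt (n * (1 - G.theta)) +
      2 * (n : ℝ) ^ (3 / 4 : ℝ) * Real.sqrt (d * M * L * R * (R + 3)) *
        G.theta ^ (1 / 4 : ℝ) := by
  have hint : ∀ t, Integrable (fun ω => G.loss t (B t ω)) P := by
    intro t
    rcases hB with rfl | rfl
    · exact integrable_loss hG (run.measurable_deployed t) (run.deployed_mem hG t) t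
    · exact integrable_loss hG (run.measurable_iterate t) (run.iterate_mem hG t) t
  have hθ0 := G.theta_nonneg
  have hθ1 := G.theta_le_one
  have hM := hG.M_pos
  have hL := hG.L_pos
  have hR := hG.one_le_R
  have hδ0 := G.delta_nonneg (M := M) (L := L) (R := R)
  have hsqrt : R * Real.sqrt (n * (G.theta * ((d : ℝ) ^ 2 * M ^ 2 / G.delta M L R ^ 2) +
      (1 - G.theta) * L ^ 2)) ≤ R * (Real.sqrt (n * G.theta) * (d * M / G.delta M L R)) +
        L * R * Real.sqrt (n * (1 - G.theta)) := by
    have h1 : n * (G.theta * ((d : ℝ) ^ 2 * M ^ 2 / G.delta M L R ^ 2) + (1 - G.theta) * L ^ 2) =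
        n * G.theta * (d * M / G.delta M L R) ^ 2 + n * (1 - G.theta) * L ^ 2 := by
      rw [div_pow, mul_pow]
      ring
    have h1' : 0 ≤ 1 - G.theta := by linarith
    rw [h1]
    have h2 := sqrt_add_le_sqrt_add_sqrt
      (by positivity : 0 ≤ n * G.theta * (d * M / G.delta M L R) ^ 2)
      (by positivity : 0 ≤ n * (1 - G.theta) * L ^ 2)
    rw [Real.sqrt_mul' _ (sq_nonneg _), Real.sqrt_mul' _ (sq_nonneg _),
      Real.sqrt_sq (by positivity), Real.sqrt_sq hL.le] at h2
    have h3 := mul_le_mul_of_nonneg_left h2 (zero_le_one.trans hR)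
    linarith
  have hmain : ∑ t, ∫ ω, G.loss t (B t ω) ∂P - (L * R * Real.sqrt (n * (1 - G.theta)) +
      2 * (n : ℝ) ^ (3 / 4 : ℝ) * Real.sqrt (d * M * L * R * (R + 3)) * G.theta ^ (1 / 4 : ℝ)) ≤
      sInf ((fun β => ∑ t, G.loss t β) '' G.K) := by
    refine le_csInf (Set.Nonempty.image _ ⟨0, G.zero_mem⟩) ?_
    rintro _ ⟨b, hb, rfl⟩
    have h1 := run.sum_integral_loss_sub_le hG hB hb
    rw [hG.smoothing_error_eq] at h1
    rw [hG.variance_term_eq] at hsqrt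
    simp only
    linarith
  unfold expectedRegret Game.regret
  rw [integral_sub (integrable_finsetSum _ fun t _ => hint t) (integrable_const _),
    integral_finsetSum _ fun t _ => hint t, integral_const]
  simp only [probReal_univ, one_smul]
  linarith

end Run

/-! ### The three regimes -/

/-- Every regime bounds `n ^ (3 / 4) θ ^ (1 / 4)` by a multiple of a power `n ^ e` with `e ≥ 1 / 2`,
which then also absorbs the `√n` of the non-strategic rounds. -/
theorem Game.Admissible.bound_le_of_theta_rpow_le {e q : ℝ} (hG : G.Admissible M L R)
    (he : 1 / 2 ≤ e)
    (hq : (n : ℝ) ^ (3 / 4 : ℝ) * G.theta ^ (1 / 4 : ℝ) ≤ q * (n : ℝ) ^ e) :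
    L * R * Real.sqrt (n * (1 - G.theta)) +
      2 * (n : ℝ) ^ (3 / 4 : ℝ) * Real.sqrt (d * M * L * R * (R + 3)) * G.theta ^ (1 / 4 : ℝ) ≤
    (L * R + 2 * Real.sqrt (M * L * R * (R + 3)) * q) * Real.sqrt d * (n : ℝ) ^ e := by
  have hR := hG.one_le_R
  have hL := hG.L_pos
  have hd : (1 : ℝ) ≤ d := by exact_mod_cast hG.dim_pos
  have hn : (1 : ℝ) ≤ n := by exact_mod_cast hG.rounds_pos
  have h1 : Real.sqrt (n * (1 - G.theta)) ≤ Real.sqrt d * (n : ℝ) ^ e := by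
    calc Real.sqrt (n * (1 - G.theta)) ≤ Real.sqrt n :=
          Real.sqrt_le_sqrt (by nlinarith [G.theta_nonneg])
      _ = (n : ℝ) ^ (1 / 2 : ℝ) := Real.sqrt_eq_rpow _
      _ ≤ (n : ℝ) ^ e := Real.rpow_le_rpow_of_exponent_le hn he
      _ ≤ Real.sqrt d * (n : ℝ) ^ e :=
          le_mul_of_one_le_left (by positivity) (Real.one_le_sqrt.2 hd)
  have h2 : Real.sqrt (d * M * L * R * (R + 3)) =
      Real.sqrt d * Real.sqrt (M * L * R * (R + 3)) := by
    rw [← Real.sqrt_mul (by linarith)]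
    ring_nf
  have h3 := mul_le_mul_of_nonneg_left h1 (by positivity : 0 ≤ L * R)
  have h4 := mul_le_mul_of_nonneg_left hq
    (by positivity : 0 ≤ 2 * (Real.sqrt d * Real.sqrt (M * L * R * (R + 3))))
  rw [h2]
  linarith

end StrategicClassification

open StrategicClassification in
theorem corollary4 :
    -- the explicit bound
    (∀ (d n : ℕ) (M L R : ℝ) (G : Game d n), G.Admissible M L R →
      ∀ (Ω : Type u) [MeasurableSpace Ω] (P : Measure Ω) [IsProbabilityMeasure P]
        (run : Run G M L R P) (B : Fin n → Ω → E d), B = run.deployed ∨ B = run.iterate →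
        Integrable (fun ω => G.regret (fun t => B t ω)) P ∧
        expectedRegret G P B ≤ L * R * Real.sqrt (n * (1 - G.theta)) +
          2 * (n : ℝ) ^ (3 / 4 : ℝ) * Real.sqrt (d * M * L * R * (R + 3)) *
            G.theta ^ (1 / 4 : ℝ)) ∧
    -- no strategic agents
    (∀ M L R : ℝ, ∃ C : ℝ, ∀ (d n : ℕ) (G : Game d n), G.Admissible M L R → G.theta = 0 →
      ∀ (Ω : Type u) [MeasurableSpace Ω] (P : Measure Ω) [IsProbabilityMeasure P]
        (run : Run G M L R P) (B : Fin n → Ω → E d), B = run.deployed ∨ B = run.iterate →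
        expectedRegret G P B ≤ C * Real.sqrt n) ∧
    -- a constant fraction of strategic agents
    (∀ M L R c : ℝ, 0 < c → ∃ C : ℝ, ∀ (d n : ℕ) (G : Game d n), G.Admissible M L R →
      c ≤ G.theta →
      ∀ (Ω : Type u) [MeasurableSpace Ω] (P : Measure Ω) [IsProbabilityMeasure P]
        (run : Run G M L R P) (B : Fin n → Ω → E d), B = run.deployed ∨ B = run.iterate →
        expectedRegret G P B ≤ C * Real.sqrt d * (n : ℝ) ^ (3 / 4 : ℝ)) ∧
    -- a polynomially small fraction of strategic agents
    (∀ M L R c γ : ℝ, 0 < c → 0 ≤ γ → γ ≤ 1 → ∃ C : ℝ, ∀ (d n : ℕ) (G : Game d n),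
      G.Admissible M L R → G.theta ≤ c * (n : ℝ) ^ (-γ) →
      ∀ (Ω : Type u) [MeasurableSpace Ω] (P : Measure Ω) [IsProbabilityMeasure P]
        (run : Run G M L R P) (B : Fin n → Ω → E d), B = run.deployed ∨ B = run.iterate →
        expectedRegret G P B ≤ C * Real.sqrt d * (n : ℝ) ^ (1 - (1 + γ) / 4)) := by
  refine ⟨fun d n M L R G hG Ω _ P _ run B hB =>
    ⟨run.integrable_regret hG hB, run.expectedRegret_le hG hB⟩, fun M L R => ?_,
    fun M L R c _ => ?_, fun M L R c γ hc hγ0 hγ1 => ?_⟩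
  · refine ⟨L * R, fun d n G hG hθ Ω _ P _ run B hB => ?_⟩
    simpa [hθ] using run.expectedRegret_le hG hB
  · refine ⟨L * R + 2 * Real.sqrt (M * L * R * (R + 3)),
      fun d n G hG _ Ω _ P _ run B hB => (run.expectedRegret_le hG hB).trans ?_⟩
    have h := hG.bound_le_of_theta_rpow_le (e := 3 / 4) (q := 1) (by norm_num)
      (by rw [one_mul]; exact mul_le_of_le_one_right (by positivity)
            (Real.rpow_le_one G.theta_nonneg G.theta_le_one (by norm_num)))
    rwa [mul_one] at h
  · refine ⟨L * R + 2 * Real.sqrt (M * L * R * (R + 3)) * c ^ (1 / 4 : ℝ),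
      fun d n G hG hθ Ω _ P _ run B hB => (run.expectedRegret_le hG hB).trans ?_⟩
    refine hG.bound_le_of_theta_rpow_le (by linarith) ?_
    have hn : (0 : ℝ) < n := by exact_mod_cast hG.rounds_pos
    calc (n : ℝ) ^ (3 / 4 : ℝ) * G.theta ^ (1 / 4 : ℝ)
        ≤ (n : ℝ) ^ (3 / 4 : ℝ) * (c * (n : ℝ) ^ (-γ)) ^ (1 / 4 : ℝ) := by
          have := G.theta_nonneg
          gcongr
      _ = c ^ (1 / 4 : ℝ) * (n : ℝ) ^ (1 - (1 + γ) / 4) := by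
          rw [Real.mul_rpow hc.le (by positivity), ← Real.rpow_mul hn.le, mul_left_comm,
            ← Real.rpow_add hn]
          ring_nf
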